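/- Let $n\ge 1$, $a>0$, and let $\Gamma:\mathbb R\to\mathbb R^{n+1}$ be a curve of class $C^{1,1}$ (that is, $C^1$ with locally Lipschitz derivative) parameterised by arc length, with tangent $T=\Gamma'$. Let $(T,N_1,\dots,N_n)$ be a relatively parallel adapted frame of $\Gamma$ with curvature vector $k=(k_1,\dots,k_n)$: the vectors $T(s),N_1(s),\dots,N_n(s)$ are orthonormal for every $s$, and for almost every $s$ one has $T'=\sum_j k_jN_j$ and $N_j'=-k_jT$ for $j=1,\dots,n$. Let $\Theta=(\Theta_1,\dots,\Theta_n):\mathbb R\to\mathbb R^n$ be locally Lipschitz with $\Theta_1^2+\dots+\Theta_n^2=1$, and suppose that $k\cdot\Theta=\sum_jk_j\Theta_j\in L^\infty(\mathbb R)$ and $a\,\|k\cdot\Theta\|_{L^\infty(\mathbb R)}<1$. On $\Omega_0=\mathbb R\times(-a,a)$ put $$f(s,t)=\sqrt{\bigl[1-t\,(k\cdot\Theta)(s)\bigr]^2+t^2\,|\Theta'(s)|^2},$$ the Jacobian of the metric $\mathrm{diag}(f^2,1)$ induced on $\Omega_0$ by the map $(s,t)\mapsto\Gamma(s)+t\sum_j\Theta_j(s)N_j(s)$.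 Let $H$ be the Dirichlet Laplace–Beltrami operator of the strip, i.e. the self-adjoint operator in $\mathcal H=L^2(\Omega_0,f\,ds\,dt)$ associated with the closed quadratic form $$h[\psi]=\int_{\Omega_0}\frac{|\partial_s\psi|^2}{f}\,ds\,dt+\int_{\Omega_0}|\partial_t\psi|^2f\,ds\,dt,$$ whose domain is the closure of $C_0^\infty(\Omega_0)$ with respect to the norm $(h[\psi]+\|\psi\|_{\mathcal H}^2)^{1/2}$. If $\Theta'=0$ almost everywhere and $k\cdot\Theta$ does not vanish almost everywhere, then the spectrum $\sigma(H)$ is a non-empty subset of $\mathbb R$, bounded from below, and $$\inf\sigma(H)<E_1:=\Bigl(\frac{\pi}{2a}\Bigr)^2 .$$ -/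

import Mathlib

open MeasureTheory
open scoped ENNReal ContDiff

namespace QuantumStrip

/-! ## Geometry of the strip -/

/-- `(T, N₁, …, Nₙ)` with `T = Γ'` is a relatively parallel adapted frame of the unit-speed curve
`Γ : ℝ → ℝⁿ⁺¹`, with curvature vector `k = (k₁, …, kₙ)`: the frame is orthonormal and, almost
everywhere, `T' = ∑ⱼ kⱼ Nⱼ` and `Nⱼ' = -kⱼ T`. (In particular `|k| = |Γ''|` almost everywhere.) -/
structure IsRelativelyParallelFrame {n : ℕ}
    (Γ : ℝ → EuclideanSpace ℝ (Fin (n + 1)))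
    (N : Fin n → ℝ → EuclideanSpace ℝ (Fin (n + 1)))
    (k : ℝ → EuclideanSpace ℝ (Fin n)) : Prop where
  orthonormal : ∀ s, Orthonormal ℝ
    (Fin.cons (deriv Γ s) (fun j => N j s) : Fin (n + 1) → EuclideanSpace ℝ (Fin (n + 1)))
  hasDerivAt_tangent : ∀ᵐ s : ℝ, HasDerivAt (deriv Γ) (∑ j, k s j • N j s) s
  hasDerivAt_normal : ∀ᵐ s : ℝ, ∀ j, HasDerivAt (N j) (-(k s j) • deriv Γ s) s

/-- The scalar product `k · Θ` of the curvature and the twisting vector, that is, the geodesic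
curvature of the reference curve in the strip. -/
noncomputable def geodesicCurvature {n : ℕ} (k Θ : ℝ → EuclideanSpace ℝ (Fin n)) (s : ℝ) : ℝ :=
  inner ℝ (k s) (Θ s)

/-- The standing assumptions on a strip of half-width `a` along `Γ` with twisting vector `Θ`. The
classes `C^{1,1}` and `C^{0,1}` are meant locally: neither the curvature of `Γ` nor `Θ'` has to be
globally bounded. -/
structure IsStrip {n : ℕ} (a : ℝ)
    (Γ : ℝ → EuclideanSpace ℝ (Fin (n + 1)))
    (N : Fin n → ℝ → EuclideanSpace ℝ (Fin (n + 1)))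
    (k Θ : ℝ → EuclideanSpace ℝ (Fin n)) : Prop where
  halfWidth_pos : 0 < a
  contDiff_curve : ContDiff ℝ 1 Γ
  locallyLipschitz_tangent : LocallyLipschitz (deriv Γ)
  unit_speed : ∀ s, ‖deriv Γ s‖ = 1
  frame : IsRelativelyParallelFrame Γ N k
  locallyLipschitz_twist : LocallyLipschitz Θ
  norm_twist : ∀ s, ‖Θ s‖ = 1
  memLp_geodesicCurvature : MemLp (geodesicCurvature k Θ) ∞ volume
  mul_norm_lt_one :
    ENNReal.ofReal a * eLpNorm (geodesicCurvature k Θ) ∞ volume < 1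

/-- The Jacobian `f(s,t) = √((1 - t (k·Θ)(s))² + t² |Θ'(s)|²)` of the metric
`g = diag(f², 1)` induced by the ruled surface `(s,t) ↦ Γ(s) + t ∑ⱼ Θⱼ(s) Nⱼ(s)`. -/
noncomputable def jacobian {n : ℕ} (k Θ : ℝ → EuclideanSpace ℝ (Fin n)) (x : ℝ × ℝ) : ℝ :=
  Real.sqrt ((1 - x.2 * geodesicCurvature k Θ x.1) ^ 2 + x.2 ^ 2 * ‖deriv Θ x.1‖ ^ 2)

/-! ## The Dirichlet Laplace-Beltrami operator

Here `f : ℝ × ℝ → ℝ` is the Jacobian of a metric `diag(f², 1)` on `ℝ × (-a, a)`. -/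

/-- The straight strip `Ω₀ = ℝ × (-a, a)`. -/
def straightStrip (a : ℝ) : Set (ℝ × ℝ) := Set.univ ×ˢ Set.Ioo (-a) a

/-- The Riemannian volume `f(s,t) ds dt` on `Ω₀`. -/
noncomputable def stripMeasure (a : ℝ) (f : ℝ × ℝ → ℝ) : Measure (ℝ × ℝ) :=
  (volume.restrict (straightStrip a)).withDensity (fun x => ENNReal.ofReal (f x))

/-- The Hilbert space `L²(Ω₀, f ds dt)`. -/
abbrev StripL2 (a : ℝ) (f : ℝ × ℝ → ℝ) : Type := Lp ℂ 2 (stripMeasure a f)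

/-- The space `C₀^∞(Ω₀)` of test functions. -/
structure IsTestFunction (a : ℝ) (φ : ℝ × ℝ → ℂ) : Prop where
  contDiff : ContDiff ℝ ∞ φ
  hasCompactSupport : HasCompactSupport φ
  tsupport_subset : tsupport φ ⊆ straightStrip a

/-- The partial derivative `∂₁ = ∂/∂s`. -/
noncomputable def partialOne (φ : ℝ × ℝ → ℂ) (x : ℝ × ℝ) : ℂ := fderiv ℝ φ x (1, 0)

/-- The partial derivative `∂₂ = ∂/∂t`. -/
noncomputable def partialTwo (φ : ℝ × ℝ → ℂ) (x : ℝ × ℝ) : ℂ := fderiv ℝ φ x (0, 1)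

theorem IsTestFunction.differentiable {a : ℝ} {φ : ℝ × ℝ → ℂ} (h : IsTestFunction a φ) :
    Differentiable ℝ φ := h.contDiff.differentiable (by simp)

theorem IsTestFunction.zero (a : ℝ) : IsTestFunction a (fun _ => 0) :=
  ⟨contDiff_const, HasCompactSupport.zero, by
    rw [show tsupport (fun _ : ℝ × ℝ => (0 : ℂ)) = ∅ from tsupport_eq_empty_iff.2 rfl]
    exact Set.empty_subset _⟩

theorem IsTestFunction.add {a : ℝ} {φ χ : ℝ × ℝ → ℂ} (hφ : IsTestFunction a φ)
    (hχ : IsTestFunction a χ) : IsTestFunction a (φ + χ) :=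
  ⟨hφ.contDiff.add hχ.contDiff, hφ.hasCompactSupport.add hχ.hasCompactSupport,
    (tsupport_add φ χ).trans (Set.union_subset hφ.tsupport_subset hχ.tsupport_subset)⟩

theorem IsTestFunction.const_smul {a : ℝ} {φ : ℝ × ℝ → ℂ} (c : ℂ) (hφ : IsTestFunction a φ) :
    IsTestFunction a (c • φ) :=
  ⟨hφ.contDiff.const_smul c, hφ.hasCompactSupport.smul_left (f := fun _ => c),
    (tsupport_smul_subset_right (fun _ => c) φ).trans hφ.tsupport_subset⟩

/-- The triples `(φ, f⁻¹ ∂₁φ, ∂₂φ)` with `φ ∈ C₀^∞(Ω₀)`, as elements of the Hilbert sum of three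
copies of `L²(Ω₀, f ds dt)`. The Hilbert norm of such a triple is the form norm
`‖φ‖₁ = (‖φ‖² + h[φ])^{1/2}`, where `h[φ] = ∫ |∂₁φ|²/f + ∫ |∂₂φ|² f`. -/
noncomputable def testTriples (a : ℝ) (f : ℝ × ℝ → ℝ) :
    Submodule ℂ (PiLp 2 (fun _ : Fin 3 => StripL2 a f)) where
  carrier := {Φ | ∃ φ : ℝ × ℝ → ℂ, IsTestFunction a φ ∧
    Φ 0 =ᵐ[stripMeasure a f] φ ∧
    Φ 1 =ᵐ[stripMeasure a f] (fun x => (f x : ℂ)⁻¹ * partialOne φ x) ∧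
    Φ 2 =ᵐ[stripMeasure a f] partialTwo φ}
  zero_mem' := by
    refine ⟨fun _ => 0, IsTestFunction.zero a, ?_, ?_, ?_⟩
    · exact Lp.coeFn_zero _ _ _
    · filter_upwards [Lp.coeFn_zero ℂ 2 (stripMeasure a f)] with x hx
      simpa [partialOne] using hx
    · filter_upwards [Lp.coeFn_zero ℂ 2 (stripMeasure a f)] with x hx
      simpa [partialTwo] using hx
  add_mem' := by
    rintro Φ Ψ ⟨φ, hφ, h0, h1, h2⟩ ⟨ψ, hψ, g0, g1, g2⟩
    refine ⟨φ + ψ, hφ.add hψ, ?_, ?_, ?_⟩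
    · filter_upwards [Lp.coeFn_add (Φ 0) (Ψ 0), h0, g0] with x hx h g
      exact hx.trans (by rw [Pi.add_apply, Pi.add_apply, h, g])
    · filter_upwards [Lp.coeFn_add (Φ 1) (Ψ 1), h1, g1] with x hx h g
      refine hx.trans ?_
      rw [Pi.add_apply, h, g, partialOne, partialOne, partialOne,
        fderiv_add (hφ.differentiable x) (hψ.differentiable x), add_apply, mul_add]
    · filter_upwards [Lp.coeFn_add (Φ 2) (Ψ 2), h2, g2] with x hx h g
      refine hx.trans ?_
      rw [Pi.add_apply, h, g, partialTwo, partialTwo, partialTwo,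
        fderiv_add (hφ.differentiable x) (hψ.differentiable x), add_apply]
  smul_mem' := by
    rintro c Φ ⟨φ, hφ, h0, h1, h2⟩
    refine ⟨c • φ, hφ.const_smul c, ?_, ?_, ?_⟩
    · filter_upwards [Lp.coeFn_smul c (Φ 0), h0] with x hx h
      simp [hx, h]
    · filter_upwards [Lp.coeFn_smul c (Φ 1), h1] with x hx h
      simp [hx, h, partialOne, fderiv_const_smul (hφ.differentiable x) c, mul_left_comm]
    · filter_upwards [Lp.coeFn_smul c (Φ 2), h2] with x hx h
      simp [hx, h, partialTwo, fderiv_const_smul (hφ.differentiable x) c]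

/-- The Hilbert space `Dom(h)` with the form norm `‖·‖₁`: the closure of `C₀^∞(Ω₀)` in that norm,
an element `ψ` of which is represented by the triple `(ψ, f⁻¹ ∂₁ψ, ∂₂ψ)`. -/
noncomputable def formSpace (a : ℝ) (f : ℝ × ℝ → ℝ) :
    Submodule ℂ (PiLp 2 (fun _ : Fin 3 => StripL2 a f)) :=
  (testTriples a f).topologicalClosure

/-- The sesquilinear form `h(φ, ψ) = ∫ conj(∂₁φ) ∂₁ψ / f ds dt + ∫ conj(∂₂φ) ∂₂ψ f ds dt`,
evaluated on triples `(φ, f⁻¹ ∂₁φ, ∂₂φ)` and `(ψ, f⁻¹ ∂₁ψ, ∂₂ψ)`. -/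
noncomputable def form {a : ℝ} {f : ℝ × ℝ → ℝ} (Φ Ψ : PiLp 2 (fun _ : Fin 3 => StripL2 a f)) : ℂ :=
  inner ℂ (Φ 1) (Ψ 1) + inner ℂ (Φ 2) (Ψ 2)

/-- The graph of the operator associated with the form `h`: the pairs `(ψ, η)` with
`ψ ∈ Dom(h)` and `h(φ, ψ) = ⟪φ, η⟫` for all `φ ∈ Dom(h)`. -/
noncomputable def hamiltonianGraph (a : ℝ) (f : ℝ × ℝ → ℝ) :
    Submodule ℂ (StripL2 a f × StripL2 a f) where
  carrier := {p | ∃ Ψ ∈ formSpace a f, Ψ 0 = p.1 ∧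
    ∀ Φ ∈ formSpace a f, form Φ Ψ = inner ℂ (Φ 0) p.2}
  zero_mem' := ⟨0, Submodule.zero_mem _, rfl, fun Φ _ => by simp [form]⟩
  add_mem' := by
    rintro p q ⟨Ψ, hΨ, h0, h⟩ ⟨Ψ', hΨ', h0', h'⟩
    refine ⟨Ψ + Ψ', Submodule.add_mem _ hΨ hΨ', by simp [h0, h0'], fun Φ hΦ => ?_⟩
    have e := h Φ hΦ
    have e' := h' Φ hΦ
    simp only [form] at e e'
    simp only [form, PiLp.add_apply, Prod.snd_add, inner_add_right, ← e, ← e']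
    ring
  smul_mem' := by
    rintro c p ⟨Ψ, hΨ, h0, h⟩
    refine ⟨c • Ψ, Submodule.smul_mem _ c hΨ, by simp [h0], fun Φ hΦ => ?_⟩
    have e := h Φ hΦ
    simp only [form] at e
    simp only [form, PiLp.smul_apply, Prod.smul_snd, inner_smul_right, ← e]
    ring

/-- The Dirichlet Laplace-Beltrami operator `H` of `(Ω₀, diag(f², 1))`: the self-adjoint operator in
`L²(Ω₀, f ds dt)` associated with the closed form `h`. -/
noncomputable def hamiltonian (a : ℝ) (f : ℝ × ℝ → ℝ) : StripL2 a f →ₗ.[ℂ] StripL2 a f :=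
  (hamiltonianGraph a f).toLinearPMap

/-- The spectrum of an unbounded operator `A`: the set of all `z ∈ ℂ` for which `A - z` does not have
a bounded, everywhere defined inverse. -/
def operatorSpectrum {E : Type*} [NormedAddCommGroup E] [NormedSpace ℂ E] (A : E →ₗ.[ℂ] E) :
    Set ℂ :=
  {z | ¬ ∃ R : E →L[ℂ] E,
    (∀ u : E, ∃ v : A.domain, (v : E) = R u ∧ A v - z • (v : E) = u) ∧
    ∀ v : A.domain, R (A v - z • (v : E)) = v}

end QuantumStrip

/-!
# A bent untwisted strip has spectrum below the threshold `(π / (2 a))²`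

If `Θ' = 0` almost everywhere, the Jacobian is `f(s, t) = 1 - t κ(s)` almost everywhere, where
`κ = k · Θ`, and `a ‖κ‖_∞ < 1` bounds it above and away from zero. The form of the strip is thus
comparable to that of a straight strip, and the theorem is the variational principle together with
a trial function.

*Variational principle.* Let `J` be the embedding of the form domain, with its form norm, into `L²`.
Then `(H + 1)⁻¹ = J J†`, a bounded positive operator of norm `‖J‖²`. The spectrum of `H` is the
image of the nonzero spectrum of `J J†` under `μ ↦ μ⁻¹ - 1` (`mem_operatorSpectrum_iff`), so it is
real with least element `‖J‖⁻² - 1` (`operatorSpectrum_of_nonneg`), and this number is less than `E`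
as soon as one function in the form domain has Rayleigh quotient less than `E`
(`operatorSpectrum_of_form`). That the graph defining `H` is single-valued uses only the density of
test functions in `L²`; closability of the form is not needed.

*Trial function.* With `u(t) = cos (π t / (2 a))` and `E₁ = (π / (2 a))²` consider
`ψ(s, t) = φ(s) u(t) + ε j(s) t u(t)`, where `φ = 1` on the support of `j`. As `u` is even and
`∫ (u'² - E₁ u²) = 0`, the curvature does not contribute to the part quadratic in `φ`, and
`h[ψ] - E₁ ‖ψ‖²` is at most `C ∫ φ'² - ε a ∫ j κ + ε² C'`. Since `κ` is not almost everywhere zero,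
`j` can be chosen with `∫ j κ ≠ 0`; a suitable small `ε` and then a wide `φ` make the sum negative
(`exists_trial_energy_neg`). The function `u` does not have compact support in `(-a, a)`; it is
replaced by cut-offs `cutoffMode`, along which all transverse integrals converge by dominated
convergence (`tendsto_integral_cutoffMode`).
-/

namespace QuantumStrip

/-! ### Operators with a bounded resolvent at `-1` -/

section Resolvent

variable {H : Type*} [NormedAddCommGroup H] [InnerProductSpace ℂ H]

/-- If `B = (A + 1)⁻¹`, in the sense that the graph of `A` consists of the pairs `(ψ, η)` with
`B (ψ + η) = ψ`, then the spectra of `A` and of `B` correspond under `z ↦ (1 + z)⁻¹`. -/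
theorem mem_operatorSpectrum_iff {A : H →ₗ.[ℂ] H} {B : H →L[ℂ] H}
    (hAB : ∀ p : H × H, p ∈ A.graph ↔ B (p.1 + p.2) = p.1) (z : ℂ) :
    z ∈ operatorSpectrum A ↔ 1 + z ≠ 0 ∧ (1 + z)⁻¹ ∈ spectrum ℂ B := by
  have hdom : ∀ v : A.domain, B (v + A v) = v := fun v => (hAB (v, A v)).1 (A.mem_graph v)
  have hran : ∀ η : H, ∃ v : A.domain, (v : H) = B η ∧ A v = η - B η := fun η => by
    have h := (hAB (B η, η - B η)).2 (by simp)
    exact (LinearPMap.mem_graph_iff A).1 h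
  rcases eq_or_ne (1 + z) 0 with hz | hz
  · have hz' : z = -1 := by linear_combination hz
    refine iff_of_false (fun h => h ⟨B, fun u => ?_, fun v => ?_⟩) (fun h => h.1 hz)
    · obtain ⟨v, hv, hAv⟩ := hran u
      exact ⟨v, hv, by rw [hAv, hv, hz']; simp⟩
    · rw [hz', neg_one_smul, sub_neg_eq_add, add_comm]
      exact hdom v
  · rw [and_iff_right hz, spectrum.mem_iff, operatorSpectrum, Set.mem_ofPred_eq, not_iff_not]
    set C : H →L[ℂ] H := algebraMap ℂ (H →L[ℂ] H) (1 + z)⁻¹ - B with hC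
    have hCη : ∀ η, C η = (1 + z)⁻¹ • η - B η := fun η => by
      simp [hC, Algebra.algebraMap_eq_smul_one]
    have hC1 : ∀ η, (1 + z) • C η = η - (1 + z) • B η := fun η => by
      rw [hCη, smul_sub, smul_smul, mul_inv_cancel₀ hz, one_smul]
    -- `A v - z v = (1 + z) C η` for `v = B η`
    have key : ∀ (v : A.domain) (η : H), (v : H) = B η → A v = η - B η →
        A v - z • (v : H) = (1 + z) • C η := fun v η hv hAv => by
      rw [hC1, hAv, hv, add_smul, one_smul]; abel
    constructor
    · rintro ⟨R, hR1, hR2⟩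
      have hRB : ∀ η, R ((1 + z) • C η) = B η := fun η => by
        obtain ⟨v, hv, hAv⟩ := hran η
        rw [← key v η hv hAv, hR2 v, hv]
      have hBR : ∀ u, B (u + (1 + z) • R u) = R u := fun u => by
        obtain ⟨v, hv, hAv⟩ := hR1 u
        have h := hdom v
        have h2 : (v : H) + A v = u + (1 + z) • R u := by
          rw [sub_eq_iff_eq_add.1 hAv, ← hv, add_smul, one_smul]; abel
        rw [← h2, h, hv]
      refine ⟨⟨C, (1 + z) • (1 + (1 + z) • R), ?_, ?_⟩, rfl⟩
      · ext u
        have h1 : C ((1 + z) • (u + (1 + z) • R u)) = u := by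
          rw [map_smul, hC1, hBR]; abel
        simpa using h1
      · ext η
        have h1 : (1 + z) • (C η + (1 + z) • R (C η)) = η := by
          have h2 := hRB η
          rw [map_smul] at h2
          rw [h2, smul_add, hC1]; abel
        simpa using h1
    · rintro ⟨⟨C', S, h1, h2⟩, rfl⟩
      have h1' : ∀ u, C (S u) = u := fun u => by simpa using congrArg (fun T => T u) h1
      have h2' : ∀ u, S (C u) = u := fun u => by simpa using congrArg (fun T => T u) h2
      refine ⟨B ∘L ((1 + z)⁻¹ • S), fun u => ?_, fun v => ?_⟩
      · obtain ⟨v, hv, hAv⟩ := hran ((1 + z)⁻¹ • S u)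
        refine ⟨v, by simpa using hv, ?_⟩
        rw [key v _ hv hAv, map_smul, h1', smul_smul, mul_inv_cancel₀ hz, one_smul]
      · have hv : (v : H) = B (v + A v) := (hdom v).symm
        rw [key v (v + A v) hv (by rw [← hv]; abel)]
        simp only [ContinuousLinearMap.comp_apply, smul_apply]
        rw [map_smul S, h2', smul_smul, inv_mul_cancel₀ hz, one_smul, ← hv]

variable [CompleteSpace H]

/-- If `(A + 1)⁻¹ = B` with `B ≥ 0` bounded and nonzero, then `A` has real spectrum, with least
element `‖B‖⁻¹ - 1`. -/
theorem operatorSpectrum_of_nonneg {A : H →ₗ.[ℂ] H} {B : H →L[ℂ] H}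
    (hAB : ∀ p : H × H, p ∈ A.graph ↔ B (p.1 + p.2) = p.1) (hB : B.IsPositive) (hB0 : B ≠ 0) :
    (∀ z ∈ operatorSpectrum A, z.im = 0) ∧
      IsLeast {x : ℝ | (x : ℂ) ∈ operatorSpectrum A} (‖B‖⁻¹ - 1) := by
  have hpos : 0 < ‖B‖ := norm_pos_iff.2 hB0
  have : Nontrivial (H →L[ℂ] H) := ⟨B, 0, hB0⟩
  have hB' : 0 ≤ B := (ContinuousLinearMap.nonneg_iff_isPositive B).2 hB
  refine ⟨fun z hz => ?_, ?_, fun x hx => ?_⟩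
  · obtain ⟨hz0, hz1⟩ := (mem_operatorSpectrum_iff hAB z).1 hz
    have h := hB.isSelfAdjoint.mem_spectrum_eq_re hz1
    have h2 : 1 + z = (((1 + z)⁻¹.re)⁻¹ : ℝ) := by
      rw [Complex.ofReal_inv, ← h, inv_inv]
    have h3 := congrArg Complex.im h2
    rw [Complex.ofReal_im] at h3
    simpa using h3
  · have h1 : ((‖B‖ : ℝ) : ℂ) ∈ spectrum ℂ B :=
      spectrum.algebraMap_mem ℂ (CStarAlgebra.norm_mem_spectrum_of_nonneg hB')
    refine (mem_operatorSpectrum_iff hAB _).2 ?_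
    have h2 : (1 : ℂ) + ((‖B‖⁻¹ - 1 : ℝ) : ℂ) = ((‖B‖ : ℝ) : ℂ)⁻¹ := by push_cast; ring
    rw [h2, inv_inv]
    exact ⟨inv_ne_zero (by exact_mod_cast hpos.ne'), h1⟩
  · obtain ⟨hz0, hz1⟩ := (mem_operatorSpectrum_iff hAB _).1 hx
    have h2 : (1 + (x : ℂ))⁻¹ = (((1 + x)⁻¹ : ℝ) : ℂ) := by push_cast; ring
    rw [h2] at hz1
    have h3 : 0 ≤ (1 + x)⁻¹ := by
      exact spectrum_nonneg_of_nonneg hB' (spectrum.of_algebraMap_mem ℂ hz1)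
    have h4 : (1 + x)⁻¹ ≤ ‖B‖ := by
      have := spectrum.norm_le_norm_of_mem hz1
      rwa [Complex.norm_real, Real.norm_of_nonneg h3] at this
    have h5 : 0 < 1 + x := lt_of_le_of_ne (inv_nonneg.1 h3) fun h => hz0 (by
      exact_mod_cast h.symm)
    have h6 := (inv_le_comm₀ h5 hpos).1 h4
    linarith

/-- The operator associated with a closed form. The form domain `V`, with the form inner product
`h(φ, ψ) + ⟪φ, ψ⟫`, is mapped into `H` by `J` with dense range; then `(A + 1)⁻¹ = J J†`. If some
Rayleigh quotient `h(ψ, ψ) / ‖ψ‖²` is less than `E`, then so is the bottom of the spectrum. -/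
theorem operatorSpectrum_of_form {V : Type*} [NormedAddCommGroup V] [InnerProductSpace ℂ V]
    [CompleteSpace V] (J : V →L[ℂ] H) (hJ : ∀ η : H, (∀ φ, inner ℂ (J φ) η = 0) → η = 0)
    (G : Submodule ℂ (H × H))
    (hG : ∀ p : H × H, p ∈ G ↔ ∃ ψ : V, J ψ = p.1 ∧
      ∀ φ, inner ℂ φ ψ - inner ℂ (J φ) (J ψ) = inner ℂ (J φ) p.2)
    {E : ℝ} {ψ : V} (hψ : ‖ψ‖ ^ 2 < (1 + E) * ‖J ψ‖ ^ 2) :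
    (∀ z ∈ operatorSpectrum G.toLinearPMap, z.im = 0) ∧
      ∃ m : ℝ, IsGLB {x : ℝ | (x : ℂ) ∈ operatorSpectrum G.toLinearPMap} m ∧ m < E := by
  set B : H →L[ℂ] H := J ∘L J.adjoint with hBdef
  have hGB : ∀ p : H × H, p ∈ G ↔ B (p.1 + p.2) = p.1 := by
    refine fun p => (hG p).trans ⟨?_, fun h => ⟨J.adjoint (p.1 + p.2), h, fun φ => ?_⟩⟩
    · rintro ⟨χ, h1, h2⟩
      have : J.adjoint (p.1 + p.2) = χ := ext_inner_left ℂ fun φ => by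
        rw [ContinuousLinearMap.adjoint_inner_right, inner_add_right, ← h2 φ, h1]; ring
      rw [hBdef, ContinuousLinearMap.comp_apply, this, h1]
    · have h' : J (J.adjoint (p.1 + p.2)) = p.1 := h
      rw [h', ContinuousLinearMap.adjoint_inner_right, inner_add_right]; ring
  have hsingle : ∀ p ∈ G, p.1 = 0 → p.2 = 0 := by
    intro p hp hp1
    obtain ⟨χ, h1, h2⟩ := (hG p).1 hp
    rw [hp1] at h1
    have h3 := h2 χ
    rw [h1, inner_zero_left, inner_zero_left, sub_zero, inner_self_eq_zero] at h3
    refine hJ _ fun φ => ?_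
    rw [← h2 φ, h3]; simp
  have hAB : ∀ p : H × H, p ∈ G.toLinearPMap.graph ↔ B (p.1 + p.2) = p.1 := by
    rw [Submodule.toLinearPMap_graph_eq G hsingle]; exact hGB
  have hJψ : 0 < ‖J ψ‖ := by
    refine (norm_nonneg _).lt_of_ne fun h => ?_
    rw [← h] at hψ
    nlinarith [sq_nonneg ‖ψ‖]
  have hE : 0 < 1 + E := by
    by_contra h
    nlinarith [sq_nonneg ‖ψ‖, sq_nonneg ‖J ψ‖]
  have hnorm : ‖B‖ = ‖J‖ * ‖J‖ := by
    have h := ContinuousLinearMap.norm_adjoint_comp_self J.adjoint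
    rw [ContinuousLinearMap.adjoint_adjoint] at h
    simpa using h
  have hlt : 1 < (1 + E) * ‖B‖ := by
    have h1 : ‖J ψ‖ ^ 2 ≤ ‖B‖ * ‖ψ‖ ^ 2 := by
      calc ‖J ψ‖ ^ 2 ≤ (‖J‖ * ‖ψ‖) ^ 2 := by gcongr; exact J.le_opNorm ψ
        _ = ‖B‖ * ‖ψ‖ ^ 2 := by rw [hnorm]; ring
    have hψ0 : 0 < ‖ψ‖ ^ 2 := by
      refine (sq_nonneg _).lt_of_ne fun h => ?_
      rw [← h, mul_zero] at h1
      nlinarith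
    have h2 : ‖ψ‖ ^ 2 < (1 + E) * ‖B‖ * ‖ψ‖ ^ 2 := by
      nlinarith [mul_le_mul_of_nonneg_left h1 hE.le]
    by_contra h
    nlinarith
  have hB0 : B ≠ 0 := by
    rintro h
    rw [h, norm_zero, mul_zero] at hlt
    linarith
  obtain ⟨him, hleast⟩ := operatorSpectrum_of_nonneg hAB
    (ContinuousLinearMap.isPositive_self_comp_adjoint J) hB0
  refine ⟨him, _, hleast.isGLB, ?_⟩
  have : ‖B‖⁻¹ < 1 + E := by
    rw [inv_lt_iff_one_lt_mul₀ (norm_pos_iff.2 hB0)]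
    linarith [mul_comm (1 + E) ‖B‖]
  linarith

end Resolvent

/-! ### The form domain -/

/-- The embedding `ψ ↦ ψ` of the form domain into `L²`; on triples, the first component. -/
noncomputable def formEmbedding (a : ℝ) (f : ℝ × ℝ → ℝ) : formSpace a f →L[ℂ] StripL2 a f :=
  PiLp.proj 2 (fun _ : Fin 3 => StripL2 a f) 0 ∘L (formSpace a f).subtypeL

/-- Test functions are dense in `L²(Ω₀, f ds dt)`, as soon as this measure is locally finite. -/
theorem eq_zero_of_inner_testFunction {a : ℝ} {f : ℝ × ℝ → ℝ}
    [IsLocallyFiniteMeasure (stripMeasure a f)]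
    (hT : ∀ φ, IsTestFunction a φ → ∃ Φ ∈ testTriples a f, Φ 0 =ᵐ[stripMeasure a f] φ)
    (η : StripL2 a f) (hη : ∀ Φ ∈ testTriples a f, inner ℂ (Φ 0) η = 0) : η = 0 := by
  have hopen : IsOpen (straightStrip a) := isOpen_univ.prod isOpen_Ioo
  have hmem : ∀ᵐ x ∂stripMeasure a f, x ∈ straightStrip a :=
    (withDensity_absolutelyContinuous _ _).ae_le (ae_restrict_mem hopen.measurableSet)
  have hloc : LocallyIntegrable η (stripMeasure a f) :=
    (Lp.memLp η).locallyIntegrable one_le_two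
  have key := hopen.ae_eq_zero_of_integral_contDiff_smul_eq_zero
    (hloc.locallyIntegrableOn (straightStrip a)) fun g hg hgc hgs => ?_
  · rw [Lp.eq_zero_iff_ae_eq_zero]
    filter_upwards [key, hmem] with x h1 h2 using h1 h2
  · have hsupp : tsupport (fun x => (g x : ℂ)) ⊆ tsupport g :=
      closure_mono fun x hx => by
        simpa [Function.mem_support] using hx
    have hφ : IsTestFunction a (fun x => (g x : ℂ)) :=
      ⟨Complex.ofRealCLM.contDiff.comp hg,
        hgc.mono' (subset_closure.trans hsupp), hsupp.trans hgs⟩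
    obtain ⟨Φ, hΦ, h0⟩ := hT _ hφ
    have h := hη Φ hΦ
    rw [L2.inner_def] at h
    rw [← h]
    refine integral_congr_ae ?_
    filter_upwards [h0] with x hx
    rw [hx]
    simp [mul_comm]

/-- The variational principle: a test function with Rayleigh quotient less than `E` shows that
the spectrum of the Laplace-Beltrami operator begins below `E`. -/
theorem operatorSpectrum_hamiltonian {a : ℝ} {f : ℝ × ℝ → ℝ}
    [IsLocallyFiniteMeasure (stripMeasure a f)]
    (hT : ∀ φ, IsTestFunction a φ → ∃ Φ ∈ testTriples a f, Φ 0 =ᵐ[stripMeasure a f] φ)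
    {E : ℝ} {Ψ : PiLp 2 (fun _ : Fin 3 => StripL2 a f)} (hΨ : Ψ ∈ testTriples a f)
    (hE : ‖Ψ 1‖ ^ 2 + ‖Ψ 2‖ ^ 2 < E * ‖Ψ 0‖ ^ 2) :
    (∀ z ∈ operatorSpectrum (hamiltonian a f), z.im = 0) ∧
      ∃ m : ℝ, IsGLB {x : ℝ | (x : ℂ) ∈ operatorSpectrum (hamiltonian a f)} m ∧ m < E := by
  have hcomplete : CompleteSpace (formSpace a f) :=
    (Submodule.isClosed_topologicalClosure _).completeSpace_coe
  have hsub : testTriples a f ≤ formSpace a f := Submodule.le_topologicalClosure _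
  refine operatorSpectrum_of_form (formEmbedding a f) (fun η hη => ?_) (hamiltonianGraph a f)
    (fun p => ?_) (ψ := ⟨Ψ, hsub hΨ⟩) ?_
  · exact eq_zero_of_inner_testFunction hT η fun Φ hΦ => hη ⟨Φ, hsub hΦ⟩
  · have hform : ∀ Φ Ψ : formSpace a f,
        inner ℂ Φ Ψ - inner ℂ (formEmbedding a f Φ) (formEmbedding a f Ψ) =
          form (Φ : PiLp 2 (fun _ : Fin 3 => StripL2 a f)) Ψ := fun Φ Ψ => by
      rw [Submodule.coe_inner, PiLp.inner_apply, Fin.sum_univ_three, form]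
      simp only [formEmbedding, ContinuousLinearMap.comp_apply, Submodule.subtypeL_apply,
        PiLp.proj_apply]
      ring
    constructor
    · rintro ⟨Ψ, hΨ, h0, h⟩
      exact ⟨⟨Ψ, hΨ⟩, h0, fun Φ => (hform Φ ⟨Ψ, hΨ⟩).trans (h Φ Φ.2)⟩
    · rintro ⟨Ψ, h0, h⟩
      exact ⟨Ψ, Ψ.2, h0, fun Φ hΦ => (hform ⟨Φ, hΦ⟩ Ψ).symm.trans (h ⟨Φ, hΦ⟩)⟩
  · have h1 : ‖(⟨Ψ, hsub hΨ⟩ : formSpace a f)‖ ^ 2 = ‖Ψ 0‖ ^ 2 + ‖Ψ 1‖ ^ 2 + ‖Ψ 2‖ ^ 2 := by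
      rw [Submodule.coe_norm, PiLp.norm_sq_eq_of_L2, Fin.sum_univ_three]
    have h2 : formEmbedding a f ⟨Ψ, hsub hΨ⟩ = Ψ 0 := rfl
    rw [h1, h2]
    linarith

/-! ### The form on test functions, for a Jacobian bounded above and below -/

section BoundedJacobian

variable {a c C : ℝ} {f : ℝ × ℝ → ℝ}

theorem measurableSet_straightStrip (a : ℝ) : MeasurableSet (straightStrip a) :=
  MeasurableSet.univ.prod measurableSet_Ioo

theorem isLocallyFiniteMeasure_stripMeasure
    (hf : ∀ᵐ x ∂volume.restrict (straightStrip a), c ≤ f x ∧ f x ≤ C) :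
    IsLocallyFiniteMeasure (stripMeasure a f) := by
  suffices h : stripMeasure a f ≤ C.toNNReal • (volume : Measure (ℝ × ℝ)) from
    ⟨fun x => (Measure.finiteAt_nhds (C.toNNReal • (volume : Measure (ℝ × ℝ))) x).measure_mono h⟩
  calc stripMeasure a f
      ≤ (volume.restrict (straightStrip a)).withDensity (fun _ => (C.toNNReal : ℝ≥0∞)) := by
        refine withDensity_mono ?_
        filter_upwards [hf] with x hx using ENNReal.ofReal_le_ofReal hx.2
    _ = C.toNNReal • volume.restrict (straightStrip a) := by
        rw [withDensity_const]; rfl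
    _ ≤ C.toNNReal • volume := by
        refine Measure.le_iff.2 fun s _ => ?_
        simp only [Measure.smul_apply]
        exact smul_le_smul_of_nonneg_left (Measure.restrict_apply_le _ _) zero_le

theorem integral_stripMeasure (hfm : AEMeasurable f (volume.restrict (straightStrip a)))
    (hf : ∀ᵐ x ∂volume.restrict (straightStrip a), 0 ≤ f x) (g : ℝ × ℝ → ℝ) :
    ∫ x, g x ∂stripMeasure a f = ∫ x in straightStrip a, g x * f x := by
  rw [stripMeasure, integral_withDensity_eq_integral_toReal_smul₀ hfm.ennreal_ofReal
    (Filter.Eventually.of_forall fun _ => ENNReal.ofReal_lt_top)]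
  refine integral_congr_ae ?_
  filter_upwards [hf] with x hx
  rw [ENNReal.toReal_ofReal hx, smul_eq_mul, mul_comm]

theorem norm_sq_stripL2 (u : StripL2 a f) {g : ℝ × ℝ → ℂ} (hg : u =ᵐ[stripMeasure a f] g) :
    ‖u‖ ^ 2 = ∫ x, ‖g x‖ ^ 2 ∂stripMeasure a f := by
  have h : ((‖u‖ ^ 2 : ℝ) : ℂ) = inner ℂ u u := by
    rw [inner_self_eq_norm_sq_to_K]; norm_cast
  rw [L2.inner_def] at h
  have h2 : ∫ x, inner ℂ (u x) (u x) ∂stripMeasure a f =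
      ∫ x, ((‖g x‖ ^ 2 : ℝ) : ℂ) ∂stripMeasure a f := by
    refine integral_congr_ae ?_
    filter_upwards [hg] with x hx
    rw [inner_self_eq_norm_sq_to_K, hx]
    norm_cast
  rw [h2, integral_complex_ofReal] at h
  exact_mod_cast h

theorem IsTestFunction.continuous_fderiv_apply {φ : ℝ × ℝ → ℂ} (h : IsTestFunction a φ)
    (v : ℝ × ℝ) : Continuous (fun x => fderiv ℝ φ x v) :=
  (h.contDiff.continuous_fderiv (by simp)).clm_apply continuous_const

theorem IsTestFunction.hasCompactSupport_fderiv_apply {φ : ℝ × ℝ → ℂ} (h : IsTestFunction a φ)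
    (v : ℝ × ℝ) : HasCompactSupport (fun x => fderiv ℝ φ x v) :=
  h.hasCompactSupport.fderiv_apply ℝ v

/-- Test functions lie in the form domain. -/
theorem exists_testTriple (hfm : AEMeasurable f (volume.restrict (straightStrip a)))
    (hc : 0 < c) (hf : ∀ᵐ x ∂volume.restrict (straightStrip a), c ≤ f x ∧ f x ≤ C)
    {φ : ℝ × ℝ → ℂ} (hφ : IsTestFunction a φ) :
    ∃ Φ ∈ testTriples a f, Φ 0 =ᵐ[stripMeasure a f] φ ∧
      Φ 1 =ᵐ[stripMeasure a f] (fun x => (f x : ℂ)⁻¹ * partialOne φ x) ∧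
      Φ 2 =ᵐ[stripMeasure a f] partialTwo φ := by
  have := isLocallyFiniteMeasure_stripMeasure hf
  have hac : stripMeasure a f ≪ volume.restrict (straightStrip a) :=
    withDensity_absolutelyContinuous _ _
  have h0 : MemLp φ 2 (stripMeasure a f) :=
    hφ.contDiff.continuous.memLp_of_hasCompactSupport hφ.hasCompactSupport
  have h1' : MemLp (partialOne φ) 2 (stripMeasure a f) :=
    (hφ.continuous_fderiv_apply _).memLp_of_hasCompactSupport
      (hφ.hasCompactSupport_fderiv_apply _)
  have h2 : MemLp (partialTwo φ) 2 (stripMeasure a f) :=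
    (hφ.continuous_fderiv_apply _).memLp_of_hasCompactSupport
      (hφ.hasCompactSupport_fderiv_apply _)
  have h1 : MemLp (fun x => (f x : ℂ)⁻¹ * partialOne φ x) 2 (stripMeasure a f) := by
    have hm : AEStronglyMeasurable (fun x => (f x : ℂ)⁻¹) (stripMeasure a f) :=
      (Complex.measurable_ofReal.comp_aemeasurable
        (hfm.mono_ac hac)).inv.aestronglyMeasurable
    refine h1'.of_le_mul (c := c⁻¹) (hm.mul h1'.aestronglyMeasurable) ?_
    filter_upwards [hac.ae_le hf] with x hx
    rw [norm_mul, norm_inv, Complex.norm_real, Real.norm_of_nonneg (hc.le.trans hx.1)]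
    gcongr
    exact hx.1
  refine ⟨WithLp.toLp 2 ![h0.toLp, h1.toLp, h2.toLp], ⟨φ, hφ, ?_, ?_, ?_⟩, ?_, ?_, ?_⟩
  exacts [h0.coeFn_toLp, h1.coeFn_toLp, h2.coeFn_toLp, h0.coeFn_toLp, h1.coeFn_toLp,
    h2.coeFn_toLp]

/-- The variational principle in coordinates, for a real-valued test function `ψ`. -/
theorem operatorSpectrum_hamiltonian_of_integral_neg
    (hfm : AEMeasurable f (volume.restrict (straightStrip a)))
    (hc : 0 < c) (hf : ∀ᵐ x ∂volume.restrict (straightStrip a), c ≤ f x ∧ f x ≤ C)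
    {ψ : ℝ × ℝ → ℝ} (hψ : ContDiff ℝ ∞ ψ) (hψc : HasCompactSupport ψ)
    (hψs : tsupport ψ ⊆ straightStrip a) {E : ℝ}
    (hneg : (∫ x in straightStrip a, (fderiv ℝ ψ x (1, 0)) ^ 2 / f x) +
      ∫ x in straightStrip a, ((fderiv ℝ ψ x (0, 1)) ^ 2 - E * ψ x ^ 2) * f x < 0) :
    (∀ z ∈ operatorSpectrum (hamiltonian a f), z.im = 0) ∧
      ∃ m : ℝ, IsGLB {x : ℝ | (x : ℂ) ∈ operatorSpectrum (hamiltonian a f)} m ∧ m < E := by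
  have := isLocallyFiniteMeasure_stripMeasure hf
  have hsupp : tsupport (fun x => (ψ x : ℂ)) ⊆ tsupport ψ :=
    closure_mono fun x hx => by simpa [Function.mem_support] using hx
  have hφ : IsTestFunction a (fun x => (ψ x : ℂ)) :=
    ⟨Complex.ofRealCLM.contDiff.comp hψ, hψc.mono' (subset_closure.trans hsupp),
      hsupp.trans hψs⟩
  have hd : ∀ x v, fderiv ℝ (fun x => (ψ x : ℂ)) x v = (fderiv ℝ ψ x v : ℂ) := fun x v => by
    have h1 : HasFDerivAt (fun x => (ψ x : ℂ)) (Complex.ofRealCLM ∘L fderiv ℝ ψ x) x :=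
      Complex.ofRealCLM.hasFDerivAt.comp x (hψ.differentiable (by simp) x).hasFDerivAt
    rw [h1.fderiv]; rfl
  obtain ⟨Φ, hΦ, h0, h1, h2⟩ := exists_testTriple hfm hc hf hφ
  have hf0 : ∀ᵐ x ∂volume.restrict (straightStrip a), 0 ≤ f x := by
    filter_upwards [hf] with x hx using hc.le.trans hx.1
  refine operatorSpectrum_hamiltonian (fun φ hφ => ?_) hΦ ?_
  · obtain ⟨Φ, hΦ, h0, -⟩ := exists_testTriple hfm hc hf hφ
    exact ⟨Φ, hΦ, h0⟩
  have e0 : ‖Φ 0‖ ^ 2 = ∫ x, ψ x ^ 2 ∂stripMeasure a f := by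
    rw [norm_sq_stripL2 _ h0]; simp
  have e2 : ‖Φ 2‖ ^ 2 = ∫ x, (fderiv ℝ ψ x (0, 1)) ^ 2 ∂stripMeasure a f := by
    rw [norm_sq_stripL2 _ h2]; simp [partialTwo, hd]
  have e1 : ‖Φ 1‖ ^ 2 = ∫ x in straightStrip a, (fderiv ℝ ψ x (1, 0)) ^ 2 / f x := by
    rw [norm_sq_stripL2 _ h1, integral_stripMeasure hfm hf0]
    refine integral_congr_ae ?_
    filter_upwards [hf] with x hx
    have : f x ≠ 0 := (hc.trans_le hx.1).ne'
    simp only [partialOne, hd, norm_mul, norm_inv, Complex.norm_real, mul_pow, inv_pow,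
      Real.norm_eq_abs, sq_abs]
    field_simp
  have i0 : Integrable (fun x => ψ x ^ 2) (stripMeasure a f) :=
    (hψ.continuous.memLp_of_hasCompactSupport hψc : MemLp ψ 2 _).integrable_sq
  have i2 : Integrable (fun x => (fderiv ℝ ψ x (0, 1)) ^ 2) (stripMeasure a f) :=
    (((hψ.continuous_fderiv (by simp)).clm_apply continuous_const).memLp_of_hasCompactSupport
      (hψc.fderiv_apply ℝ _) : MemLp _ 2 _).integrable_sq
  rw [← integral_stripMeasure hfm hf0, integral_sub i2 (i0.const_mul E), integral_const_mul,
    ← e0, ← e1, ← e2] at hneg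
  linarith

end BoundedJacobian

/-! ### Cut-offs of the transverse ground state -/

section Transverse

open Filter Topology

variable {a : ℝ}

/-- The ground state `cos (π t / (2 a))` of the Dirichlet Laplacian on `(-a, a)`, multiplied by a
smooth cut-off that vanishes where `a² - t² ≤ 1 / L` and equals `1` where `a² - t² ≥ 2 / L`. -/
noncomputable def cutoffMode (a L t : ℝ) : ℝ :=
  Real.cos (Real.pi / (2 * a) * t) * Real.smoothTransition (L * (a ^ 2 - t ^ 2) - 1)

theorem contDiff_cutoffMode (a L : ℝ) : ContDiff ℝ ∞ (cutoffMode a L) := by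
  unfold cutoffMode
  have h : ContDiff ℝ ∞ Real.smoothTransition := Real.smoothTransition.contDiff
  exact (Real.contDiff_cos.comp (contDiff_const.mul contDiff_id)).mul
    (h.comp (by fun_prop))

theorem cutoffMode_neg (a L t : ℝ) : cutoffMode a L (-t) = cutoffMode a L t := by
  simp [cutoffMode]

theorem cutoffMode_eq_zero {L t : ℝ} (h : L * (a ^ 2 - t ^ 2) ≤ 1) : cutoffMode a L t = 0 := by
  rw [cutoffMode, Real.smoothTransition.zero_of_nonpos (by linarith), mul_zero]

theorem tsupport_cutoffMode_subset {L : ℝ} (ha : 0 < a) (hL : 0 < L) :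
    tsupport (cutoffMode a L) ⊆ Set.Ioo (-a) a := by
  have hsub : tsupport (cutoffMode a L) ⊆ {t | 1 ≤ L * (a ^ 2 - t ^ 2)} := by
    refine closure_minimal (fun t ht => ?_) (isClosed_le continuous_const (by fun_prop))
    by_contra h
    exact ht (cutoffMode_eq_zero (not_le.1 h).le)
  refine hsub.trans fun t (ht : 1 ≤ L * (a ^ 2 - t ^ 2)) => ?_
  have h : 0 < a ^ 2 - t ^ 2 := by
    by_contra h
    nlinarith
  exact abs_lt.1 (abs_lt_of_sq_lt_sq (by linarith) ha.le)

theorem hasCompactSupport_cutoffMode {L : ℝ} (ha : 0 < a) (hL : 0 < L) :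
    HasCompactSupport (cutoffMode a L) :=
  isCompact_Icc.of_isClosed_subset (isClosed_tsupport _)
    ((tsupport_cutoffMode_subset ha hL).trans Set.Ioo_subset_Icc_self)

theorem hasDerivAt_cutoffMode (a L t : ℝ) :
    HasDerivAt (cutoffMode a L)
      (-Real.sin (Real.pi / (2 * a) * t) * (Real.pi / (2 * a)) *
          Real.smoothTransition (L * (a ^ 2 - t ^ 2) - 1) +
        Real.cos (Real.pi / (2 * a) * t) *
          (deriv Real.smoothTransition (L * (a ^ 2 - t ^ 2) - 1) * (L * (-(2 * t))))) t := by
  have hS : Differentiable ℝ Real.smoothTransition :=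
    (Real.smoothTransition.contDiff (n := 1)).differentiable (by simp)
  have h1 : HasDerivAt (fun t => Real.pi / (2 * a) * t) (Real.pi / (2 * a)) t := by
    simpa using (hasDerivAt_id t).const_mul (Real.pi / (2 * a))
  have h2 : HasDerivAt (fun t => L * (a ^ 2 - t ^ 2) - 1) (L * (-(2 * t))) t := by
    have := (((hasDerivAt_pow 2 t).const_sub (a ^ 2)).const_mul L).sub_const 1
    simpa using this
  exact h1.cos.mul ((hS _).hasDerivAt.comp t h2)

theorem abs_cutoffMode_le_one (a L t : ℝ) : |cutoffMode a L t| ≤ 1 := by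
  rw [cutoffMode, abs_mul, abs_of_nonneg (Real.smoothTransition.nonneg _)]
  exact mul_le_one₀ (Real.abs_cos_le_one _) (Real.smoothTransition.nonneg _)
    (Real.smoothTransition.le_one _)

/-- The ground state vanishes linearly at the ends of the interval. -/
theorem abs_cos_le_of_mem (ha : 0 < a) {t : ℝ} (ht : t ∈ Set.Ioo (-a) a) :
    |Real.cos (Real.pi / (2 * a) * t)| ≤ Real.pi / (2 * a ^ 2) * (a ^ 2 - t ^ 2) := by
  have hw : 0 < Real.pi / (2 * a) := by positivity
  have hat : |t| < a := abs_lt.2 ht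
  have hwa : Real.pi / (2 * a) * a = Real.pi / 2 := by field_simp
  have h1 : Real.cos (Real.pi / (2 * a) * t) = Real.sin (Real.pi / (2 * a) * (a - |t|)) := by
    rw [← Real.cos_abs, abs_mul, abs_of_pos hw, ← Real.sin_pi_div_two_sub, mul_sub, hwa]
  have h2 : 0 ≤ Real.pi / (2 * a) * (a - |t|) := mul_nonneg hw.le (by linarith)
  have h3 : 0 ≤ Real.cos (Real.pi / (2 * a) * t) := by
    rw [h1]
    refine Real.sin_nonneg_of_nonneg_of_le_pi h2 ?_
    nlinarith [mul_nonneg hw.le (abs_nonneg t), Real.pi_pos]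
  rw [abs_of_nonneg h3, h1]
  refine (Real.sin_le h2).trans ?_
  have h4 : Real.pi / (2 * a ^ 2) * (a ^ 2 - t ^ 2) =
      Real.pi / (2 * a) * (a - |t|) * ((a + |t|) / a) := by
    rw [← sq_abs t]
    field_simp
    ring
  rw [h4]
  refine le_mul_of_one_le_right h2 ((one_le_div ha).2 ?_)
  linarith [abs_nonneg t]

/-- The derivatives of the cut-off modes are bounded uniformly in the cut-off: where the cut-off
has slope of order `L`, the ground state is of order `1 / L`. -/
theorem exists_abs_deriv_cutoffMode_le (ha : 0 < a) :
    ∃ K, ∀ L, 0 ≤ L → ∀ t ∈ Set.Ioo (-a) a, |deriv (cutoffMode a L) t| ≤ K := by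
  have hcont : Continuous (deriv Real.smoothTransition) :=
    (Real.smoothTransition.contDiff (n := 1)).continuous_deriv le_rfl
  obtain ⟨K, hK⟩ := (isCompact_Icc (a := (-1 : ℝ)) (b := 1)).exists_bound_of_continuousOn
    hcont.continuousOn
  have hK0 : 0 ≤ K := (norm_nonneg _).trans (hK 0 (by norm_num))
  refine ⟨Real.pi / (2 * a) + Real.pi / a * 2 * K, fun L hL t ht => ?_⟩
  have hw : 0 < Real.pi / (2 * a) := by positivity
  have hat : |t| < a := abs_lt.2 ht
  have ht2 : 0 ≤ a ^ 2 - t ^ 2 := by nlinarith [sq_abs t, abs_nonneg t]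
  rw [(hasDerivAt_cutoffMode a L t).deriv]
  refine (abs_add_le _ _).trans (add_le_add ?_ ?_)
  · rw [abs_mul, abs_mul, abs_neg, abs_of_pos hw,
      abs_of_nonneg (Real.smoothTransition.nonneg _)]
    have h1 := Real.abs_sin_le_one (Real.pi / (2 * a) * t)
    have h2 := Real.smoothTransition.le_one (L * (a ^ 2 - t ^ 2) - 1)
    have h3 := Real.smoothTransition.nonneg (L * (a ^ 2 - t ^ 2) - 1)
    calc _ ≤ 1 * (Real.pi / (2 * a)) * 1 := by gcongr
      _ = _ := by ring
  · rcases le_or_gt (L * (a ^ 2 - t ^ 2) - 1) 1 with h | h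
    · have hb := hK (L * (a ^ 2 - t ^ 2) - 1) ⟨by nlinarith [mul_nonneg hL ht2], h⟩
      rw [Real.norm_eq_abs] at hb
      rw [abs_mul, abs_mul, abs_mul, abs_neg, abs_mul, abs_of_nonneg hL, abs_two]
      calc _ ≤ Real.pi / (2 * a ^ 2) * (a ^ 2 - t ^ 2) * (K * (L * (2 * a))) := by
            gcongr
            exact abs_cos_le_of_mem ha ht
        _ = Real.pi / a * (L * (a ^ 2 - t ^ 2)) * K := by field_simp
        _ ≤ Real.pi / a * 2 * K := by
            have : L * (a ^ 2 - t ^ 2) ≤ 2 := by linarith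
            gcongr
    · have h0 : deriv Real.smoothTransition (L * (a ^ 2 - t ^ 2) - 1) = 0 := by
        have : Real.smoothTransition =ᶠ[𝓝 (L * (a ^ 2 - t ^ 2) - 1)] fun _ => 1 := by
          filter_upwards [lt_mem_nhds h] with x hx
          exact Real.smoothTransition.one_of_one_le hx.le
        rw [this.deriv_eq, deriv_const]
      rw [h0, zero_mul, mul_zero, abs_zero]
      positivity

/-- Integrals of continuous expressions in `t`, `u` and `u'` pass to the limit when `u` runs
through the cut-offs of the ground state. -/
theorem tendsto_integral_cutoffMode (ha : 0 < a) {G : ℝ → ℝ → ℝ → ℝ}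
    (hG : Continuous fun x : ℝ × ℝ × ℝ => G x.1 x.2.1 x.2.2) :
    Tendsto (fun L => ∫ t in Set.Ioo (-a) a, G t (cutoffMode a L t) (deriv (cutoffMode a L) t))
      atTop (𝓝 (∫ t in Set.Ioo (-a) a, G t (Real.cos (Real.pi / (2 * a) * t))
        (-Real.sin (Real.pi / (2 * a) * t) * (Real.pi / (2 * a))))) := by
  obtain ⟨K, hK⟩ := exists_abs_deriv_cutoffMode_le ha
  obtain ⟨M, hM⟩ := ((isCompact_Icc (a := -a) (b := a)).prod
    ((isCompact_Icc (a := (-1 : ℝ)) (b := 1)).prod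
      (isCompact_Icc (a := -K) (b := K)))).exists_bound_of_continuousOn hG.continuousOn
  refine tendsto_integral_filter_of_dominated_convergence (fun _ => M) ?_ ?_ ?_ ?_
  · refine Eventually.of_forall fun L => Continuous.aestronglyMeasurable ?_
    have h1 : Continuous (cutoffMode a L) := (contDiff_cutoffMode a L).continuous
    have h2 : Continuous (deriv (cutoffMode a L)) :=
      (contDiff_cutoffMode a L).continuous_deriv (by simp)
    exact hG.comp (continuous_id.prodMk (h1.prodMk h2))
  · filter_upwards [eventually_ge_atTop 0] with L hL
    filter_upwards [ae_restrict_mem measurableSet_Ioo] with t ht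
    exact hM (t, cutoffMode a L t, deriv (cutoffMode a L) t)
      ⟨Set.Ioo_subset_Icc_self ht, abs_le.1 (abs_cutoffMode_le_one a L t),
        abs_le.1 (hK L hL t ht)⟩
  · exact integrable_const M
  · filter_upwards [ae_restrict_mem measurableSet_Ioo] with t ht
    refine tendsto_const_nhds.congr' ?_
    have ht2 : 0 < a ^ 2 - t ^ 2 := by nlinarith [ht.1, ht.2]
    filter_upwards [eventually_gt_atTop (2 / (a ^ 2 - t ^ 2))] with L hL
    have h2 : 2 < L * (a ^ 2 - t ^ 2) := (div_lt_iff₀ ht2).1 hL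
    have hev : cutoffMode a L =ᶠ[𝓝 t] fun t => Real.cos (Real.pi / (2 * a) * t) := by
      have hc : ContinuousAt (fun t => L * (a ^ 2 - t ^ 2)) t := by fun_prop
      filter_upwards [hc.eventually_const_lt h2] with x hx
      rw [cutoffMode, Real.smoothTransition.one_of_one_le (by linarith), mul_one]
    have hd : HasDerivAt (fun t => Real.cos (Real.pi / (2 * a) * t))
        (-Real.sin (Real.pi / (2 * a) * t) * (Real.pi / (2 * a))) t := by
      have h1 : HasDerivAt (fun t => Real.pi / (2 * a) * t) (Real.pi / (2 * a)) t := by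
        simpa using (hasDerivAt_id t).const_mul (Real.pi / (2 * a))
      exact h1.cos
    rw [hev.deriv_eq, hd.deriv, hev.eq_of_nhds]

theorem setIntegral_Ioo_eq_sub (ha : 0 < a) {F F' : ℝ → ℝ} (hF : ∀ t, HasDerivAt F (F' t) t)
    (hF' : Continuous F') : ∫ t in Set.Ioo (-a) a, F' t = F a - F (-a) := by
  rw [← integral_Ioc_eq_integral_Ioo, ← intervalIntegral.integral_of_le (by linarith)]
  exact intervalIntegral.integral_eq_sub_of_hasDerivAt (fun t _ => hF t)
    (hF'.intervalIntegrable _ _)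

theorem setIntegral_Ioo_eq_zero_of_odd (ha : 0 < a) {g : ℝ → ℝ} (hg : ∀ t, g (-t) = -g t) :
    ∫ t in Set.Ioo (-a) a, g t = 0 := by
  rw [← integral_Ioc_eq_integral_Ioo, ← intervalIntegral.integral_of_le (by linarith)]
  have h := intervalIntegral.integral_comp_neg (a := -a) (b := a) g
  simp only [hg, intervalIntegral.integral_neg, neg_neg] at h
  linarith

/-- The cut-off ground state has Rayleigh quotient tending to `E₁ = (π / (2 a))²`. -/
theorem tendsto_integral_cutoffMode_energy (ha : 0 < a) :
    Tendsto (fun L => ∫ t in Set.Ioo (-a) a, ((deriv (cutoffMode a L) t) ^ 2 -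
      (Real.pi / (2 * a)) ^ 2 * cutoffMode a L t ^ 2)) atTop (𝓝 0) := by
  have h := tendsto_integral_cutoffMode ha
    (G := fun _ u u' => u' ^ 2 - (Real.pi / (2 * a)) ^ 2 * u ^ 2) (by fun_prop)
  convert h using 2
  set w := Real.pi / (2 * a) with hw
  have hwa : w * a = Real.pi / 2 := by rw [hw]; field_simp
  rw [setIntegral_Ioo_eq_sub ha (F := fun t => -w * (Real.sin (w * t) * Real.cos (w * t)))
    (fun t => ?_) (by fun_prop)]
  · simp [hwa]
  · have h1 : HasDerivAt (fun t => w * t) w t := by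
      simpa using (hasDerivAt_id t).const_mul w
    refine ((h1.sin.mul h1.cos).const_mul (-w)).congr_deriv ?_
    ring

/-- The coefficient of the geodesic curvature in the form, between the ground state `u` and its
perturbation `t u`. -/
theorem tendsto_integral_cutoffMode_cross (ha : 0 < a) :
    Tendsto (fun L => ∫ t in Set.Ioo (-a) a, t * (deriv (cutoffMode a L) t *
        (cutoffMode a L t + t * deriv (cutoffMode a L) t) -
      (Real.pi / (2 * a)) ^ 2 * (cutoffMode a L t * (t * cutoffMode a L t)))) atTop
      (𝓝 (a / 2)) := by
  have h := tendsto_integral_cutoffMode ha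
    (G := fun t u u' => t * (u' * (u + t * u') - (Real.pi / (2 * a)) ^ 2 * (u * (t * u))))
    (by fun_prop)
  convert h using 2
  set w := Real.pi / (2 * a) with hw
  have hw0 : w ≠ 0 := by rw [hw]; positivity
  have hwa : w * a = Real.pi / 2 := by rw [hw]; field_simp
  rw [setIntegral_Ioo_eq_sub ha
    (F := fun t => -(w * t ^ 2 * (Real.sin (w * t) * Real.cos (w * t))) -
      t / 4 * (Real.cos (w * t) ^ 2 - Real.sin (w * t) ^ 2) +
      1 / (4 * w) * (Real.sin (w * t) * Real.cos (w * t))) (fun t => ?_) (by fun_prop)]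
  · simp [hwa]
    ring
  · have h1 : HasDerivAt (fun t => w * t) w t := by
      simpa using (hasDerivAt_id t).const_mul w
    have h2 := h1.sin.mul h1.cos
    have h3 : HasDerivAt (fun t : ℝ => w * t ^ 2) (w * (2 * t)) t := by
      simpa using (hasDerivAt_pow 2 t).const_mul w
    have h4 : HasDerivAt (fun t : ℝ => t / 4) (1 / 4) t := (hasDerivAt_id t).div_const 4
    refine (((h3.mul h2).neg.sub (h4.mul ((h1.cos.pow 2).sub (h1.sin.pow 2)))).add
      (h2.const_mul (1 / (4 * w)))).congr_deriv ?_
    simp only [Pi.mul_apply, Pi.sub_apply, Pi.pow_apply]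
    field_simp
    ring

end Transverse

/-! ### The trial function -/

section Trial

open Filter Topology

variable {a : ℝ}

theorem volume_restrict_straightStrip (a : ℝ) :
    (volume : Measure (ℝ × ℝ)).restrict (straightStrip a) =
      (volume : Measure ℝ).prod (volume.restrict (Set.Ioo (-a) a)) := by
  rw [straightStrip, Measure.volume_eq_prod, ← Measure.prod_restrict, Measure.restrict_univ]

theorem integral_straightStrip_mul (F G : ℝ → ℝ) :
    ∫ x in straightStrip a, F x.1 * G x.2 = (∫ s, F s) * ∫ t in Set.Ioo (-a) a, G t := by
  rw [volume_restrict_straightStrip, integral_prod_mul]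

theorem integrable_straightStrip_mul {F G : ℝ → ℝ} (hF : Integrable F) (hG : Continuous G) :
    Integrable (fun x : ℝ × ℝ => F x.1 * G x.2) (volume.restrict (straightStrip a)) := by
  rw [volume_restrict_straightStrip]
  exact hF.mul_prod ((hG.integrableOn_Icc (a := -a) (b := a)).mono_set Set.Ioo_subset_Icc_self)

/-- Integration of a product `F(s) G(t)` against the Jacobian `1 - t κ(s)` of an untwisted strip. -/
theorem integral_mul_untwisted {κ F G : ℝ → ℝ} {M : ℝ} (hκm : AEStronglyMeasurable κ)
    (hκ : ∀ᵐ s, |κ s| ≤ M) (hF : Continuous F) (hFc : HasCompactSupport F) (hG : Continuous G) :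
    Integrable (fun x : ℝ × ℝ => F x.1 * G x.2 * (1 - x.2 * κ x.1))
        (volume.restrict (straightStrip a)) ∧
      ∫ x in straightStrip a, F x.1 * G x.2 * (1 - x.2 * κ x.1) =
        (∫ s, F s) * (∫ t in Set.Ioo (-a) a, G t) -
          (∫ s, F s * κ s) * ∫ t in Set.Ioo (-a) a, t * G t := by
  have hFi := hF.integrable_of_hasCompactSupport (μ := volume) hFc
  have hFκ : Integrable (fun s => F s * κ s) := hFi.mul_bdd hκm hκ
  have i1 := integrable_straightStrip_mul (a := a) hFi hG
  have i2 := integrable_straightStrip_mul (a := a) (G := fun t => t * G t) hFκ (by fun_prop)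
  have e : (fun x : ℝ × ℝ => F x.1 * G x.2 * (1 - x.2 * κ x.1)) =
      fun x => F x.1 * G x.2 - (F x.1 * κ x.1) * (x.2 * G x.2) := by
    ext x; ring
  rw [e]
  refine ⟨i1.sub i2, ?_⟩
  rw [integral_sub i1 i2]
  have h2 := integral_straightStrip_mul (a := a) (fun s => F s * κ s) (fun t => t * G t)
  rw [integral_straightStrip_mul, ← h2]

/-- The function `φ(s) u(t) + j(s) t u(t)`. -/
def trial (φ j u : ℝ → ℝ) (x : ℝ × ℝ) : ℝ := φ x.1 * u x.2 + j x.1 * (x.2 * u x.2)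

variable {φ j u : ℝ → ℝ}

theorem contDiff_trial (hφ : ContDiff ℝ ∞ φ) (hj : ContDiff ℝ ∞ j) (hu : ContDiff ℝ ∞ u) :
    ContDiff ℝ ∞ (trial φ j u) :=
  ((hφ.comp contDiff_fst).mul (hu.comp contDiff_snd)).add
    ((hj.comp contDiff_fst).mul (contDiff_snd.mul (hu.comp contDiff_snd)))

theorem tsupport_trial_subset (φ j u : ℝ → ℝ) :
    tsupport (trial φ j u) ⊆ (tsupport φ ∪ tsupport j) ×ˢ tsupport u := by
  refine closure_minimal (fun x hx => ?_)
    (((isClosed_tsupport φ).union (isClosed_tsupport j)).prod (isClosed_tsupport u))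
  by_contra h
  rw [Set.mem_prod, not_and_or, Set.mem_union, not_or] at h
  refine hx ?_
  rcases h with ⟨h1, h2⟩ | h
  · simp [trial, image_eq_zero_of_notMem_tsupport h1, image_eq_zero_of_notMem_tsupport h2]
  · simp [trial, image_eq_zero_of_notMem_tsupport h]

theorem fderiv_trial (hφ : Differentiable ℝ φ) (hj : Differentiable ℝ j)
    (hu : Differentiable ℝ u) (x : ℝ × ℝ) :
    fderiv ℝ (trial φ j u) x (1, 0) = deriv φ x.1 * u x.2 + deriv j x.1 * (x.2 * u x.2) ∧
    fderiv ℝ (trial φ j u) x (0, 1) =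
      φ x.1 * deriv u x.2 + j x.1 * (u x.2 + x.2 * deriv u x.2) := by
  have h0 : HasFDerivAt (fun x : ℝ × ℝ => x.1) (ContinuousLinearMap.fst ℝ ℝ ℝ) x :=
    hasFDerivAt_fst
  have h4 : HasFDerivAt (fun x : ℝ × ℝ => x.2) (ContinuousLinearMap.snd ℝ ℝ ℝ) x :=
    hasFDerivAt_snd
  have h1 := (hφ x.1).hasDerivAt.comp_hasFDerivAt x h0
  have h2 := (hj x.1).hasDerivAt.comp_hasFDerivAt x h0
  have h3 := (hu x.2).hasDerivAt.comp_hasFDerivAt x h4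
  have h := (h1.mul h3).add (h2.mul (h4.mul h3))
  have e : fderiv ℝ (trial φ j u) x = _ := HasFDerivAt.fderiv h
  rw [e]
  constructor
  · simp; ring
  · simp; ring

/-- The transverse part of the form. Since `u` is even, the geodesic curvature enters through the
interaction of `u` with `t u` only. -/
theorem integral_trial_transverse {κ : ℝ → ℝ} {M : ℝ} (ha : 0 < a)
    (hκm : AEStronglyMeasurable κ) (hκ : ∀ᵐ s, |κ s| ≤ M)
    (hφ : ContDiff ℝ ∞ φ) (hφc : HasCompactSupport φ)
    (hj : ContDiff ℝ ∞ j) (hjc : HasCompactSupport j) (hu : ContDiff ℝ ∞ u)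
    (hu_even : ∀ t, u (-t) = u t) (hφj : ∀ s, φ s * j s = j s) (E : ℝ) :
    ∫ x in straightStrip a, ((fderiv ℝ (trial φ j u) x (0, 1)) ^ 2 - E * trial φ j u x ^ 2) *
        (1 - x.2 * κ x.1) =
      (∫ s, φ s ^ 2) * (∫ t in Set.Ioo (-a) a, ((deriv u t) ^ 2 - E * u t ^ 2)) -
        2 * (∫ s, j s * κ s) * (∫ t in Set.Ioo (-a) a,
          t * (deriv u t * (u t + t * deriv u t) - E * (u t * (t * u t)))) +
        (∫ s, j s ^ 2) * ∫ t in Set.Ioo (-a) a,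
          ((u t + t * deriv u t) ^ 2 - E * (t * u t) ^ 2) := by
  have hu0 : Continuous u := hu.continuous
  have hu1 : Continuous (deriv u) := hu.continuous_deriv (by simp)
  have hd_odd : ∀ t, deriv u (-t) = -deriv u t := fun t => by
    have h := deriv_comp_neg u t
    rw [funext hu_even] at h
    rw [h, neg_neg]
  have hφ2c : HasCompactSupport fun s => φ s ^ 2 :=
    hφc.comp_left (g := fun y => y ^ 2) (by simp)
  have hj2c : HasCompactSupport fun s => j s ^ 2 :=
    hjc.comp_left (g := fun y => y ^ 2) (by simp)
  obtain ⟨i1, e1⟩ := integral_mul_untwisted (a := a) hκm hκ (F := fun s => φ s ^ 2)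
    (G := fun t => (deriv u t) ^ 2 - E * u t ^ 2) (hφ.continuous.pow 2) hφ2c (by fun_prop)
  obtain ⟨i2, e2⟩ := integral_mul_untwisted (a := a) hκm hκ (F := j)
    (G := fun t => deriv u t * (u t + t * deriv u t) - E * (u t * (t * u t)))
    hj.continuous hjc (by fun_prop)
  obtain ⟨i3, e3⟩ := integral_mul_untwisted (a := a) hκm hκ (F := fun s => j s ^ 2)
    (G := fun t => (u t + t * deriv u t) ^ 2 - E * (t * u t) ^ 2)
    (hj.continuous.pow 2) hj2c (by fun_prop)
  rw [setIntegral_Ioo_eq_zero_of_odd ha (g := fun t => t * ((deriv u t) ^ 2 - E * u t ^ 2))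
    (fun t => by rw [hd_odd, hu_even]; ring), mul_zero, sub_zero] at e1
  rw [setIntegral_Ioo_eq_zero_of_odd ha
    (g := fun t => deriv u t * (u t + t * deriv u t) - E * (u t * (t * u t)))
    (fun t => by rw [hd_odd, hu_even]; ring), mul_zero, zero_sub] at e2
  rw [setIntegral_Ioo_eq_zero_of_odd ha
    (g := fun t => t * ((u t + t * deriv u t) ^ 2 - E * (t * u t) ^ 2))
    (fun t => by rw [hd_odd, hu_even]; ring), mul_zero, sub_zero] at e3
  have hexp : ∀ x : ℝ × ℝ,
      ((fderiv ℝ (trial φ j u) x (0, 1)) ^ 2 - E * trial φ j u x ^ 2) * (1 - x.2 * κ x.1) =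
      φ x.1 ^ 2 * ((deriv u x.2) ^ 2 - E * u x.2 ^ 2) * (1 - x.2 * κ x.1) +
      2 * (j x.1 * (deriv u x.2 * (u x.2 + x.2 * deriv u x.2) -
        E * (u x.2 * (x.2 * u x.2))) * (1 - x.2 * κ x.1)) +
      j x.1 ^ 2 * ((u x.2 + x.2 * deriv u x.2) ^ 2 - E * (x.2 * u x.2) ^ 2) *
        (1 - x.2 * κ x.1) := fun x => by
    rw [(fderiv_trial (hφ.differentiable (by simp)) (hj.differentiable (by simp))
      (hu.differentiable (by simp)) x).2, trial]
    linear_combination (2 * (deriv u x.2 * (u x.2 + x.2 * deriv u x.2) -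
        E * (u x.2 * (x.2 * u x.2))) * (1 - x.2 * κ x.1)) * hφj x.1
  simp only [hexp]
  have i12 : Integrable (fun x : ℝ × ℝ =>
      φ x.1 ^ 2 * ((deriv u x.2) ^ 2 - E * u x.2 ^ 2) * (1 - x.2 * κ x.1) +
      2 * (j x.1 * (deriv u x.2 * (u x.2 + x.2 * deriv u x.2) -
        E * (u x.2 * (x.2 * u x.2))) * (1 - x.2 * κ x.1)))
      (volume.restrict (straightStrip a)) := i1.add (i2.const_mul 2)
  rw [integral_add i12 i3, integral_add i1 (i2.const_mul 2),
    integral_const_mul, e1, e2, e3]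
  ring

theorem integral_trial_longitudinal_le {f : ℝ × ℝ → ℝ} {c : ℝ} (hc : 0 < c)
    (hf : ∀ᵐ x ∂volume.restrict (straightStrip a), c ≤ f x)
    (hφ : ContDiff ℝ ∞ φ) (hφc : HasCompactSupport φ)
    (hj : ContDiff ℝ ∞ j) (hjc : HasCompactSupport j) (hu : ContDiff ℝ ∞ u)
    (hφj : ∀ s, deriv φ s * deriv j s = 0) :
    ∫ x in straightStrip a, (fderiv ℝ (trial φ j u) x (1, 0)) ^ 2 / f x ≤
      c⁻¹ * ((∫ s, (deriv φ s) ^ 2) * (∫ t in Set.Ioo (-a) a, u t ^ 2) +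
        (∫ s, (deriv j s) ^ 2) * ∫ t in Set.Ioo (-a) a, (t * u t) ^ 2) := by
  have hu0 : Continuous u := hu.continuous
  have hi : ∀ {g : ℝ → ℝ}, ContDiff ℝ ∞ g → HasCompactSupport g →
      Integrable fun s => (deriv g s) ^ 2 := fun {g} hg hgc => by
    have h1 : Continuous (deriv g) := hg.continuous_deriv (by simp)
    have h2 : HasCompactSupport fun s => (deriv g s) ^ 2 :=
      hgc.deriv.comp_left (g := fun y : ℝ => y ^ 2) (by simp)
    exact (h1.pow 2).integrable_of_hasCompactSupport h2
  have i1 := integrable_straightStrip_mul (a := a) (G := fun t => u t ^ 2) (hi hφ hφc) (by fun_prop)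
  have i2 := integrable_straightStrip_mul (a := a) (G := fun t => (t * u t) ^ 2) (hi hj hjc)
    (by fun_prop)
  have e1 := integral_straightStrip_mul (a := a) (fun s => (deriv φ s) ^ 2) (fun t => u t ^ 2)
  have e2 := integral_straightStrip_mul (a := a) (fun s => (deriv j s) ^ 2)
    (fun t => (t * u t) ^ 2)
  rw [← e1, ← e2, ← integral_add i1 i2, ← integral_const_mul]
  refine integral_mono_of_nonneg ?_ ((i1.add i2).const_mul _) ?_
  · filter_upwards [hf] with x hx
    have := hc.trans_le hx
    simp only [Pi.zero_apply]
    positivity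
  · filter_upwards [hf] with x hx
    have h : (fderiv ℝ (trial φ j u) x (1, 0)) ^ 2 =
        deriv φ x.1 ^ 2 * u x.2 ^ 2 + deriv j x.1 ^ 2 * (x.2 * u x.2) ^ 2 := by
      rw [(fderiv_trial (hφ.differentiable (by simp)) (hj.differentiable (by simp))
        (hu.differentiable (by simp)) x).1]
      linear_combination (2 * u x.2 * (x.2 * u x.2)) * hφj x.1
    simp only [h]
    rw [div_eq_inv_mul]
    gcongr

/-- Longitudinal cut-offs equal to `1` on `[-R, R]`, with Dirichlet energy of order `1 / R`. -/
theorem exists_longitudinal_cutoff : ∃ D : ℝ, ∀ R > 0, ∃ φ : ℝ → ℝ, ContDiff ℝ ∞ φ ∧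
    HasCompactSupport φ ∧ (∀ s, |s| ≤ R → φ s = 1) ∧ ∫ s, (deriv φ s) ^ 2 = D / R := by
  let b : ContDiffBump (0 : ℝ) := ⟨1, 2, one_pos, one_lt_two⟩
  refine ⟨∫ s, (deriv b s) ^ 2, fun R hR => ⟨fun s => b (s / R), ?_, ?_, fun s hs => ?_, ?_⟩⟩
  · exact b.contDiff.comp (contDiff_id.div_const R)
  · simpa [div_eq_mul_inv, Function.comp_def] using
      b.hasCompactSupport.comp_homeomorph (Homeomorph.mulRight₀ R⁻¹ (inv_ne_zero hR.ne'))
  · refine b.one_of_mem_closedBall ?_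
    rw [mem_closedBall_zero_iff, Real.norm_eq_abs, abs_div, abs_of_pos hR]
    exact (div_le_one hR).2 hs
  · have hd : ∀ s, deriv (fun s => b (s / R)) s = deriv b (s / R) / R := fun s => by
      have h1 : HasDerivAt (fun s : ℝ => s / R) (1 / R) s := (hasDerivAt_id s).div_const R
      have h2 : HasDerivAt b (deriv b (s / R)) (s / R) :=
        ((b.contDiff (n := 1)).differentiable (by simp) _).hasDerivAt
      have h3 := h2.comp s h1
      rw [mul_one_div] at h3
      exact h3.deriv
    simp only [hd, div_pow]
    rw [integral_div, Measure.integral_comp_div (fun y => (deriv b y) ^ 2), abs_of_pos hR,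
      smul_eq_mul]
    field_simp

/-- A bent untwisted strip has a test function with Rayleigh quotient below
`E₁ = (π / (2 a))²`. -/
theorem exists_trial_energy_neg {κ : ℝ → ℝ} {M c : ℝ} {f : ℝ × ℝ → ℝ} (ha : 0 < a)
    (hκm : AEStronglyMeasurable κ) (hκ : ∀ᵐ s, |κ s| ≤ M) (hκ0 : ¬ ∀ᵐ s, κ s = 0)
    (hc : 0 < c) (hfc : ∀ᵐ x ∂volume.restrict (straightStrip a), c ≤ f x)
    (hf : ∀ᵐ x ∂volume.restrict (straightStrip a), f x = 1 - x.2 * κ x.1) :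
    ∃ ψ : ℝ × ℝ → ℝ, ContDiff ℝ ∞ ψ ∧ HasCompactSupport ψ ∧ tsupport ψ ⊆ straightStrip a ∧
      (∫ x in straightStrip a, (fderiv ℝ ψ x (1, 0)) ^ 2 / f x) +
        ∫ x in straightStrip a,
          ((fderiv ℝ ψ x (0, 1)) ^ 2 - (Real.pi / (2 * a)) ^ 2 * ψ x ^ 2) * f x < 0 := by
  set E : ℝ := (Real.pi / (2 * a)) ^ 2 with hE
  obtain ⟨j, hj, hjc, hK⟩ : ∃ j : ℝ → ℝ, ContDiff ℝ ∞ j ∧ HasCompactSupport j ∧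
      ∫ s, j s * κ s ≠ 0 := by
    by_contra! h
    exact hκ0 (ae_eq_zero_of_integral_contDiff_smul_eq_zero
      ((memLp_top_of_bound hκm M hκ).locallyIntegrable le_top) h)
  set K := ∫ s, j s * κ s
  obtain ⟨r, hr⟩ := hjc.isCompact.isBounded.exists_norm_le
  -- limits of the transverse integrals as the cut-off is removed
  have t1 := tendsto_integral_cutoffMode_energy ha
  have t2 := tendsto_integral_cutoffMode_cross ha
  have t3 := tendsto_integral_cutoffMode ha (G := fun t u u' => (u + t * u') ^ 2 - E * (t * u) ^ 2)
    (by fun_prop)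
  have t4 := tendsto_integral_cutoffMode ha (G := fun _ u _ => u ^ 2) (by fun_prop)
  have t5 := tendsto_integral_cutoffMode ha (G := fun t u _ => (t * u) ^ 2) (by fun_prop)
  generalize (∫ t in Set.Ioo (-a) a, (Real.cos (Real.pi / (2 * a) * t) +
    t * (-Real.sin (Real.pi / (2 * a) * t) * (Real.pi / (2 * a)))) ^ 2 -
      E * (t * Real.cos (Real.pi / (2 * a) * t)) ^ 2) = I3 at t3
  generalize (∫ t in Set.Ioo (-a) a, Real.cos (Real.pi / (2 * a) * t) ^ 2) = I4 at t4
  generalize (∫ t in Set.Ioo (-a) a, (t * Real.cos (Real.pi / (2 * a) * t)) ^ 2) = I5 at t5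
  -- the size `ε` of the perturbation makes the part of the form linear in `ε` dominate
  set A : ℝ := c⁻¹ * ((∫ s, (deriv j s) ^ 2) * I5) + (∫ s, j s ^ 2) * I3 with hA
  obtain ⟨ε, hε⟩ : ∃ ε : ℝ, ε ^ 2 * A - ε * K * a < 0 := by
    refine ⟨K * (a / (|A| + 1)), ?_⟩
    have h1 : 0 < a / (|A| + 1) := by positivity
    have h2 : a / (|A| + 1) * A < a := by
      rw [div_mul_eq_mul_div, div_lt_iff₀ (by positivity)]
      nlinarith [le_abs_self A]
    have h3 : 0 < K ^ 2 * (a / (|A| + 1)) := by positivity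
    nlinarith
  -- the longitudinal cut-off `φ`
  obtain ⟨D, hD⟩ := exists_longitudinal_cutoff
  obtain ⟨R, hRr, hR0, hR⟩ : ∃ R : ℝ, r < R ∧ 0 < R ∧
      c⁻¹ * (D / R * I4) + (ε ^ 2 * A - ε * K * a) < 0 := by
    have : Tendsto (fun R : ℝ => c⁻¹ * (D / R * I4) + (ε ^ 2 * A - ε * K * a)) atTop
        (𝓝 (c⁻¹ * (0 * I4) + (ε ^ 2 * A - ε * K * a))) :=
      (((tendsto_const_nhds.div_atTop tendsto_id).mul_const I4).const_mul c⁻¹).add_const _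
    rw [zero_mul, mul_zero, zero_add] at this
    obtain ⟨R, h1, h2, h3⟩ := ((this.eventually_lt_const hε).and
      ((eventually_gt_atTop r).and (eventually_gt_atTop 0))).exists
    exact ⟨R, h2, h3, h1⟩
  obtain ⟨φ, hφ, hφc, hφ1, hφE⟩ := hD R hR0
  have hφj : ∀ s, φ s * (ε * j s) = ε * j s := fun s => by
    by_cases hs : s ∈ tsupport j
    · rw [hφ1 s ((hr s hs).trans hRr.le), one_mul]
    · rw [image_eq_zero_of_notMem_tsupport hs]; simp
  have hdj : ∀ s, deriv (fun s => ε * j s) s = ε * deriv j s := fun s =>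
    deriv_const_mul ε (hj.differentiable (by simp) s)
  have hdφj : ∀ s, deriv φ s * deriv (fun s => ε * j s) s = 0 := fun s => by
    rw [hdj]
    by_cases hs : s ∈ tsupport j
    · have : φ =ᶠ[𝓝 s] fun _ => 1 := by
        filter_upwards [continuous_abs.continuousAt.eventually_lt_const
          (show |s| < R from (hr s hs).trans_lt hRr)] with y hy using hφ1 y hy.le
      rw [this.deriv_eq, deriv_const, zero_mul]
    · have h0 : deriv j s = 0 := by
        by_contra h
        exact hs (support_deriv_subset h)
      rw [h0, mul_zero, mul_zero]
  -- the transverse cut-off `L`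
  have hlim := (((t4.const_mul (∫ s, (deriv φ s) ^ 2)).add
    (t5.const_mul (ε ^ 2 * ∫ s, (deriv j s) ^ 2))).const_mul c⁻¹).add
    (((t1.const_mul (∫ s, φ s ^ 2)).sub (t2.const_mul (2 * (ε * K)))).add
      (t3.const_mul (ε ^ 2 * ∫ s, j s ^ 2)))
  have hneg : c⁻¹ * ((∫ s, (deriv φ s) ^ 2) * I4 + (ε ^ 2 * ∫ s, (deriv j s) ^ 2) * I5) +
      ((∫ s, φ s ^ 2) * 0 - 2 * (ε * K) * (a / 2) + (ε ^ 2 * ∫ s, j s ^ 2) * I3) < 0 := by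
    refine lt_of_eq_of_lt ?_ hR
    rw [hφE, hA]; ring
  obtain ⟨L, hL, hL0⟩ := ((hlim.eventually_lt_const hneg).and (eventually_gt_atTop 0)).exists
  have hu := contDiff_cutoffMode a L
  have hεj : ContDiff ℝ ∞ fun s => ε * j s := contDiff_const.mul hj
  have hεjc : HasCompactSupport fun s => ε * j s := hjc.mul_left
  have hsupp := tsupport_trial_subset φ (fun s => ε * j s) (cutoffMode a L)
  refine ⟨trial φ (fun s => ε * j s) (cutoffMode a L), contDiff_trial hφ hεj hu, ?_, ?_, ?_⟩
  · exact ((hφc.isCompact.union hεjc.isCompact).prod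
      (hasCompactSupport_cutoffMode ha hL0).isCompact).of_isClosed_subset
        (isClosed_tsupport _) hsupp
  · exact hsupp.trans (Set.prod_mono (Set.subset_univ _) (tsupport_cutoffMode_subset ha hL0))
  · have b1 := integral_trial_longitudinal_le hc hfc hφ hφc hεj hεjc hu hdφj
    have b2 := integral_trial_transverse ha hκm hκ hφ hφc hεj hεjc hu (cutoffMode_neg a L) hφj E
    have e2 : ∫ x in straightStrip a,
        ((fderiv ℝ (trial φ (fun s => ε * j s) (cutoffMode a L)) x (0, 1)) ^ 2 -
          E * trial φ (fun s => ε * j s) (cutoffMode a L) x ^ 2) * f x = _ :=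
      (integral_congr_ae (by filter_upwards [hf] with x hx; rw [hx])).trans b2
    rw [e2]
    refine lt_of_le_of_lt (add_le_add_left b1 _) ?_
    simp only [hdj, mul_pow, mul_assoc, integral_const_mul] at hL ⊢
    exact hL

end Trial

end QuantumStrip

theorem theorem4p1 {n : ℕ} (hn : 1 ≤ n) (a : ℝ)
    (Γ : ℝ → EuclideanSpace ℝ (Fin (n + 1)))
    (N : Fin n → ℝ → EuclideanSpace ℝ (Fin (n + 1)))
    (k Θ : ℝ → EuclideanSpace ℝ (Fin n))
    (hstrip : QuantumStrip.IsStrip a Γ N k Θ)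
    (huntwisted : ∀ᵐ s : ℝ, deriv Θ s = 0)
    (hbent : ¬ ∀ᵐ s : ℝ, QuantumStrip.geodesicCurvature k Θ s = 0) :
    (∀ z ∈ QuantumStrip.operatorSpectrum
        (QuantumStrip.hamiltonian a (QuantumStrip.jacobian k Θ)), z.im = 0) ∧
    ∃ m : ℝ, IsGLB {x : ℝ | (x : ℂ) ∈ QuantumStrip.operatorSpectrum
        (QuantumStrip.hamiltonian a (QuantumStrip.jacobian k Θ))} m ∧
      m < (Real.pi / (2 * a)) ^ 2 := by
  have ha := hstrip.halfWidth_pos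
  set κ := QuantumStrip.geodesicCurvature k Θ with hκdef
  set f := QuantumStrip.jacobian k Θ with hfdef
  obtain ⟨hκm, hκtop⟩ := hstrip.memLp_geodesicCurvature
  set M : ℝ := (eLpNorm κ ∞ volume).toReal with hM
  have hκ : ∀ᵐ s, |κ s| ≤ M := by
    filter_upwards [ae_le_eLpNormEssSup (f := κ) (μ := volume)] with s hs
    rw [← eLpNorm_exponent_top] at hs
    simpa [hM] using ENNReal.toReal_mono hκtop.ne hs
  have haM : a * M < 1 := by
    have h := (ENNReal.toReal_lt_toReal (hstrip.mul_norm_lt_one.trans ENNReal.one_lt_top).ne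
      ENNReal.one_ne_top).2 hstrip.mul_norm_lt_one
    rwa [ENNReal.toReal_mul, ENNReal.toReal_ofReal ha.le, ENNReal.toReal_one] at h
  have hfst : ∀ {p : ℝ → Prop}, (∀ᵐ s, p s) →
      ∀ᵐ x ∂volume.restrict (QuantumStrip.straightStrip a), p x.1 := fun hp =>
    ae_restrict_of_ae (Measure.quasiMeasurePreserving_fst.ae hp)
  have hbound : ∀ᵐ x ∂volume.restrict (QuantumStrip.straightStrip a),
      |x.2 * κ x.1| ≤ a * M := by
    filter_upwards [hfst hκ, ae_restrict_mem (QuantumStrip.measurableSet_straightStrip a)]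
      with x h1 h2
    rw [abs_mul]
    exact mul_le_mul (abs_lt.2 h2.2).le h1 (abs_nonneg _) ha.le
  have hf : ∀ᵐ x ∂volume.restrict (QuantumStrip.straightStrip a), f x = 1 - x.2 * κ x.1 := by
    filter_upwards [hfst huntwisted, hbound] with x h1 h2
    rw [hfdef, QuantumStrip.jacobian, h1, norm_zero, ← hκdef]
    rw [zero_pow two_ne_zero, mul_zero, add_zero, Real.sqrt_sq]
    linarith [(abs_le.1 h2).2]
  have hfb : ∀ᵐ x ∂volume.restrict (QuantumStrip.straightStrip a),
      1 - a * M ≤ f x ∧ f x ≤ 1 + a * M := by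
    filter_upwards [hf, hbound] with x h1 h2
    rw [h1]
    constructor <;> linarith [(abs_le.1 h2).1, (abs_le.1 h2).2]
  have hfm : AEMeasurable f (volume.restrict (QuantumStrip.straightStrip a)) := by
    have h1 : AEMeasurable (fun x : ℝ × ℝ => κ x.1)
        (volume.restrict (QuantumStrip.straightStrip a)) :=
      (hκm.aemeasurable.comp_quasiMeasurePreserving
        Measure.quasiMeasurePreserving_fst).restrict
    exact ((measurable_snd.aemeasurable.mul h1).const_sub 1).congr
      (by filter_upwards [hf] with x hx using hx.symm)
  obtain ⟨ψ, hψ, hψc, hψs, hneg⟩ := QuantumStrip.exists_trial_energy_neg ha hκm hκ hbent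
    (sub_pos.2 haM) (hfb.mono fun x hx => hx.1) hf
  exact QuantumStrip.operatorSpectrum_hamiltonian_of_integral_neg hfm (sub_pos.2 haM) hfb
    hψ hψc hψs hneg
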